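/- Let $d\ge 2$. There is a finite constant $C=C_d$ with the following property. Let $A$ be a locally integrable (real- or complex-valued) function on $\mathbb R^d$ whose weak gradient $\nabla A=(\partial_1A,\dots,\partial_dA)$ belongs to the Lorentz space $L^{d,1}(\mathbb R^d)$, where $$\|\nabla A\|_{L^{d,1}(\mathbb R^d)}=\frac1d\int_0^\infty t^{1/d}\,|\nabla A|^*(t)\,\frac{dt}{t},\qquad |\nabla A|=\Big(\sum_{i=1}^d|\partial_iA|^2\Big)^{1/2},$$ and $g^*(t)=\inf\{s\ge0: |\{x\in\mathbb R^d:|g(x)|>s\}|\le t\}$ is the decreasing rearrangement. Then $A$ agrees almost everywhere with a (unique) continuous function, and, taking $A$ to be this continuous representative, the Mary Weiss maximal function $$\mathcal M(\nabla A)(x)=\sup_{h\in\mathbb R^d\setminus\{0\}}\frac{|A(x+h)-A(x)|}{|h|}$$ satisfies, for every $\lambda>0$, $$\lambda^d\,\big|\{x\in\mathbb R^d:\mathcal M(\nabla A)(x)>\lambda\}\big|\le C\,\|\nabla A\|_{L^{d,1}(\mathbb R^d)}^d .$$ That is, $\mathcal M$ maps $L^{d,1}(\mathbb R^d)$ to $L^{d,\infty}(\mathbb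 R^d)$. -/

import Mathlib

open MeasureTheory
open scoped ENNReal NNReal

noncomputable section

/-- Decreasing rearrangement `f*(t) = inf {s ≥ 0 : μ {|f| > s} ≤ t}`. -/
def decreasingRearrangement {α F : Type*} [MeasurableSpace α] [ENorm F]
    (μ : Measure α) (f : α → F) (t : ℝ≥0∞) : ℝ≥0∞ :=
  sInf {s : ℝ≥0∞ | μ {x | s < ‖f x‖ₑ} ≤ t}

/-- The Lorentz (quasi-)norm
`‖f‖_{p,q} = ((q/p) ∫₀^∞ (t^{1/p} f*(t))^q dt/t)^{1/q}` for `0 < p, q < ∞`.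
With this normalization `‖χ_E‖_{p,q} = μ(E)^{1/p}`. -/
def lorentzNorm {α F : Type*} [MeasurableSpace α] [ENorm F]
    (μ : Measure α) (p q : ℝ) (f : α → F) : ℝ≥0∞ :=
  (ENNReal.ofReal (q / p) *
    ∫⁻ t in Set.Ioi (0 : ℝ),
      (ENNReal.ofReal t ^ (1 / p) *
        decreasingRearrangement μ f (ENNReal.ofReal t)) ^ q / ENNReal.ofReal t) ^ (1 / q)

/-- Membership in the Lorentz space `L^{p,q}(μ)`. -/
def MemLorentz {α F : Type*} [MeasurableSpace α] [NormedAddCommGroup F]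
    (μ : Measure α) (p q : ℝ) (f : α → F) : Prop :=
  AEStronglyMeasurable f μ ∧ lorentzNorm μ p q f < ⊤

/-- `G = (∂₁A, …, ∂_dA)` in the sense of weak derivatives on `ℝ^d`. The norm of `G x` is
`(∑ᵢ |∂ᵢA(x)|²)^{1/2}`. -/
structure IsWeakGradient {𝕜 : Type*} [RCLike 𝕜] {d : ℕ}
    (A : EuclideanSpace ℝ (Fin d) → 𝕜)
    (G : EuclideanSpace ℝ (Fin d) → EuclideanSpace 𝕜 (Fin d)) : Prop where
  locallyIntegrable : LocallyIntegrable A volume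
  locallyIntegrable_grad : LocallyIntegrable G volume
  integral_eq : ∀ φ : EuclideanSpace ℝ (Fin d) → ℝ, ContDiff ℝ (⊤ : ℕ∞) φ → HasCompactSupport φ →
    ∀ i : Fin d,
      ∫ x, (fderiv ℝ φ x (EuclideanSpace.single i 1)) • A x = - ∫ x, φ x • G x i

/-- The Mary Weiss maximal function `sup_{h ≠ 0} |A(x+h) - A(x)| / |h|`. -/
def maryWeissMaximal {𝕜 : Type*} [RCLike 𝕜] {d : ℕ}
    (A : EuclideanSpace ℝ (Fin d) → 𝕜) (x : EuclideanSpace ℝ (Fin d)) : ℝ≥0∞ :=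
  ⨆ (h : EuclideanSpace ℝ (Fin d)) (_ : h ≠ 0), ‖A (x + h) - A x‖ₑ / ‖h‖ₑ

end

/-! Write `N(S) = ∫₀^∞ |{y ∈ S : |G y| > s}|^{1/d} ds`, which for `S = ℝ^d` is at most the `L^{d,1}`
norm. The heart of the matter is a local embedding: a smooth average of `A` at scale `r` near `x`
differs from the continuous representative at `x` by at most a constant times `N(B(x, 2r))`.

Halving the scale `t` changes the average by at most a constant times `t^{1-d} ∫_{B(x,Rt)} |G|`.
Summed over dyadic `t ≤ r` and split into level sets of `|G|`, a level set meeting the largest ball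
in measure `ρ^d` contributes about `∑ t^{1-d} min(t, ρ)^d`. Since `d ≥ 2` this is geometric on both
sides of `t = ρ`, hence comparable to `ρ` at most (`sum_dyadic_integral_le`). Absolute continuity of
`N` makes the averages converge uniformly.

Comparing `x` and `x + h` with one average at scale `|h|` gives `|A(x+h) - A(x)| ≲ N(B(x, 3|h|))`.
Each point with large maximal function is then the centre of a ball with `λρ ≲ N(B(x, ρ))`. Vitali's
lemma selects disjoint balls, and `∑ N(Bᵢ)^d ≤ N(ℝ^d)^d` by Minkowski's inequality
(`sum_lorentzIntegral_pow_le`), which is the weak-type bound. -/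

/-- The average `∫ t⁻ᵈ χ((x - y) / t) A(y) dy` of `A` at scale `t` with profile `χ`. -/
noncomputable def kernelAverage {𝕜 : Type*} [RCLike 𝕜] {d : ℕ} (χ : EuclideanSpace ℝ (Fin d) → ℝ)
    (A : EuclideanSpace ℝ (Fin d) → 𝕜) (x : EuclideanSpace ℝ (Fin d)) (t : ℝ) : 𝕜 :=
  ∫ y, ((t ^ d)⁻¹ * χ (t⁻¹ • (x - y))) • A y

/-! ### Dependence of the averages on the scale. -/

section KernelAverage

variable {𝕜 : Type*} [RCLike 𝕜] {d : ℕ}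

lemma profile_eq_zero_of_notMem {V : Type*} [Zero V] {η : EuclideanSpace ℝ (Fin d) → V} {R : ℝ}
    (hη : ∀ ζ, R < ‖ζ‖ → η ζ = 0) {t : ℝ} (ht : 0 < t) (x : EuclideanSpace ℝ (Fin d))
    {y : EuclideanSpace ℝ (Fin d)} (hy : y ∉ Metric.closedBall x (R * t)) :
    η (t⁻¹ • (x - y)) = 0 := by
  apply hη
  rw [Metric.mem_closedBall, not_le, dist_eq_norm, norm_sub_rev] at hy
  rw [norm_smul, norm_inv, Real.norm_of_nonneg ht.le, inv_mul_eq_div, lt_div_iff₀ ht]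
  exact hy

lemma integrable_profile_smul {F : Type*} [NormedAddCommGroup F] [NormedSpace ℝ F]
    {η : EuclideanSpace ℝ (Fin d) → ℝ} (hc : Continuous η) {R : ℝ}
    (hη : ∀ ζ, R < ‖ζ‖ → η ζ = 0) {A : EuclideanSpace ℝ (Fin d) → F}
    (hA : LocallyIntegrable A volume) {t : ℝ} (ht : 0 < t) (x : EuclideanSpace ℝ (Fin d)) :
    Integrable (fun y => η (t⁻¹ • (x - y)) • A y) := by
  apply hA.integrable_smul_left_of_hasCompactSupport
  · fun_prop
  · exact HasCompactSupport.intro (isCompact_closedBall x (R * t))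
      fun y hy => profile_eq_zero_of_notMem hη ht x hy

lemma exists_forall_abs_le_of_profile {η : EuclideanSpace ℝ (Fin d) → ℝ} (hc : Continuous η)
    {R : ℝ} (hη : ∀ ζ, R < ‖ζ‖ → η ζ = 0) : ∃ M, 0 ≤ M ∧ ∀ ζ, |η ζ| ≤ M := by
  obtain ⟨M, hM⟩ := (HasCompactSupport.intro (isCompact_closedBall 0 R) (f := η) fun y hy =>
    hη y (by simpa using hy)).exists_bound_of_continuous hc
  exact ⟨M, (norm_nonneg _).trans (hM 0), hM⟩

lemma fderiv_profile_eq_zero {χ : EuclideanSpace ℝ (Fin d) → ℝ} {R : ℝ}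
    (hχ : ∀ ζ, R < ‖ζ‖ → χ ζ = 0) {ζ : EuclideanSpace ℝ (Fin d)} (hζ : R < ‖ζ‖) :
    fderiv ℝ χ ζ = 0 := by
  have h : χ =ᶠ[nhds ζ] fun _ => 0 := by
    filter_upwards [(isOpen_lt continuous_const continuous_norm).mem_nhds hζ] with z hz
    exact hχ z hz
  rw [h.fderiv_eq, fderiv_const_apply]

lemma hasDerivAt_kernel {χ : EuclideanSpace ℝ (Fin d) → ℝ} (hχ : Differentiable ℝ χ)
    {t : ℝ} (ht : 0 < t) (z : EuclideanSpace ℝ (Fin d)) :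
    HasDerivAt (fun s : ℝ => (s ^ d)⁻¹ * χ (s⁻¹ • z))
      (-((t ^ (d + 1))⁻¹ * (d * χ (t⁻¹ • z) + fderiv ℝ χ (t⁻¹ • z) (t⁻¹ • z)))) t := by
  have h1 : HasDerivAt (fun s : ℝ => s⁻¹ • z) (-(t ^ 2)⁻¹ • z) t :=
    (hasDerivAt_inv ht.ne').smul_const z
  have h2 := (hχ (t⁻¹ • z)).hasFDerivAt.comp_hasDerivAt t h1
  have h3 : HasDerivAt (fun s : ℝ => (s ^ d)⁻¹) (-(d * t ^ (d - 1)) / (t ^ d) ^ 2) t :=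
    (hasDerivAt_pow d t).fun_inv (pow_ne_zero _ ht.ne')
  refine (h3.mul h2).congr_deriv ?_
  rw [map_smul, map_smul]
  simp only [Function.comp, smul_eq_mul]
  -- The exponent `d - 1` is truncated, so `d = 0` is treated apart.
  rcases Nat.eq_zero_or_pos d with rfl | hd
  · simp; field_simp
  · obtain ⟨n, rfl⟩ := Nat.exists_eq_succ_of_ne_zero hd.ne'
    simp only [Nat.succ_eq_add_one, Nat.add_sub_cancel]
    field_simp
    ring

lemma hasDerivAt_kernelAverage {χ : EuclideanSpace ℝ (Fin d) → ℝ} (hχ : ContDiff ℝ (⊤ : ℕ∞) χ)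
    {R : ℝ} (hR : 0 ≤ R) (hs : ∀ ζ, R < ‖ζ‖ → χ ζ = 0) {A : EuclideanSpace ℝ (Fin d) → 𝕜}
    (hA : LocallyIntegrable A volume) (x : EuclideanSpace ℝ (Fin d)) {t : ℝ} (ht : 0 < t) :
    HasDerivAt (kernelAverage χ A x)
      (∫ y, (-((t ^ (d + 1))⁻¹ * (d * χ (t⁻¹ • (x - y)) +
        fderiv ℝ χ (t⁻¹ • (x - y)) (t⁻¹ • (x - y))))) • A y) t := by
  set ψ : EuclideanSpace ℝ (Fin d) → ℝ := fun ζ => d * χ ζ + fderiv ℝ χ ζ ζ with hψ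
  have hfc : Continuous (fderiv ℝ χ) := hχ.continuous_fderiv (by simp)
  have hψc : Continuous ψ := by
    have := hχ.continuous
    fun_prop
  have hψs : ∀ ζ, R < ‖ζ‖ → ψ ζ = 0 := by
    intro ζ hζ
    simp [hψ, hs ζ hζ, fderiv_profile_eq_zero hs hζ]
  obtain ⟨M, hM0, hM⟩ := exists_forall_abs_le_of_profile hψc hψs
  have hint : ∀ c : ℝ, ∀ s : ℝ, 0 < s → ∀ η : EuclideanSpace ℝ (Fin d) → ℝ, Continuous η →
      (∀ ζ, R < ‖ζ‖ → η ζ = 0) → Integrable (fun y => (c * η (s⁻¹ • (x - y))) • A y) := by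
    intro c s hs0 η hη hη0
    simp_rw [mul_smul]
    exact (integrable_profile_smul hη hη0 hA hs0 x).smul c
  refine (hasDerivAt_integral_of_dominated_loc_of_deriv_le
    (F := fun s y => ((s ^ d)⁻¹ * χ (s⁻¹ • (x - y))) • A y)
    (F' := fun s y => (-((s ^ (d + 1))⁻¹ * ψ (s⁻¹ • (x - y)))) • A y)
    (s := Set.Ioo (t / 2) (2 * t))
    (bound := (Metric.closedBall x (R * (2 * t))).indicator
      fun y => ((t / 2) ^ (d + 1))⁻¹ * M * ‖A y‖)
    (Ioo_mem_nhds (by linarith) (by linarith)) ?_ ?_ ?_ ?_ ?_ ?_).2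
  · filter_upwards [lt_mem_nhds ht] with s hs0
    exact (hint _ s hs0 χ hχ.continuous hs).aestronglyMeasurable
  · exact hint _ t ht χ hχ.continuous hs
  · simp_rw [← neg_mul]
    exact (hint _ t ht ψ hψc hψs).aestronglyMeasurable
  · refine Filter.Eventually.of_forall fun y s hs' => ?_
    have hs0 : 0 < s := by linarith [hs'.1]
    by_cases hy : y ∈ Metric.closedBall x (R * (2 * t))
    · rw [Set.indicator_of_mem hy, norm_smul, norm_neg, norm_mul]
      gcongr
      · rw [norm_inv, norm_pow, Real.norm_of_nonneg hs0.le]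
        gcongr
        exact hs'.1.le
      · exact hM _
    · have hy' : y ∉ Metric.closedBall x (R * s) := fun h =>
        hy (Metric.closedBall_subset_closedBall (mul_le_mul_of_nonneg_left hs'.2.le hR) h)
      simp [Set.indicator_of_notMem hy, profile_eq_zero_of_notMem hψs hs0 x hy']
  · rw [integrable_indicator_iff measurableSet_closedBall]
    exact ((hA.integrableOn_isCompact (isCompact_closedBall _ _)).norm).const_mul _
  · refine Filter.Eventually.of_forall fun y s hs' => ?_
    have hs0 : 0 < s := by linarith [hs'.1]
    exact (hasDerivAt_kernel (hχ.differentiable (by simp)) hs0 (x - y)).smul_const (A y)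

lemma fderiv_coord_mul_profile {χ : EuclideanSpace ℝ (Fin d) → ℝ} (hχ : Differentiable ℝ χ)
    (x y : EuclideanSpace ℝ (Fin d)) (t : ℝ) (i : Fin d) :
    fderiv ℝ (fun y => (t⁻¹ • (x - y)) i * χ (t⁻¹ • (x - y))) y (EuclideanSpace.single i 1) =
      -(t⁻¹ * (χ (t⁻¹ • (x - y)) +
        (t⁻¹ • (x - y)) i * fderiv ℝ χ (t⁻¹ • (x - y)) (EuclideanSpace.single i 1))) := by
  have h1 : HasFDerivAt (fun y : EuclideanSpace ℝ (Fin d) => t⁻¹ • (x - y))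
      (t⁻¹ • -ContinuousLinearMap.id ℝ (EuclideanSpace ℝ (Fin d))) y :=
    ((hasFDerivAt_id y).const_sub x).const_smul t⁻¹
  have h2 := (hχ (t⁻¹ • (x - y))).hasFDerivAt.comp y h1
  have h3 := (EuclideanSpace.proj i : EuclideanSpace ℝ (Fin d) →L[ℝ] ℝ).hasFDerivAt.comp y h1
  have h4 := h3.mul h2
  have h5 : HasFDerivAt (fun y => (t⁻¹ • (x - y)) i * χ (t⁻¹ • (x - y))) _ y := h4
  rw [h5.fderiv]
  simp
  ring

lemma sum_coord_mul_apply (L : EuclideanSpace ℝ (Fin d) →L[ℝ] ℝ) (z : EuclideanSpace ℝ (Fin d)) :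
    ∑ i, z i * L (EuclideanSpace.single i 1) = L z := by
  conv_rhs => rw [← (EuclideanSpace.basisFun (Fin d) ℝ).sum_repr z]
  simp [map_sum]

/-- With `ζ = (x - y) / t`, the factor `d χ + ζ · ∇χ` is the divergence of `ζ χ(ζ)`. The scale
derivative of the kernel is therefore a divergence in `y`, and the weak gradient, tested on each `ζᵢ
χ(ζ)`, takes over the derivative. -/
lemma integral_deriv_kernel_eq {χ : EuclideanSpace ℝ (Fin d) → ℝ} (hχ : ContDiff ℝ (⊤ : ℕ∞) χ)
    {R : ℝ} (hs : ∀ ζ, R < ‖ζ‖ → χ ζ = 0) {A : EuclideanSpace ℝ (Fin d) → 𝕜}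
    {G : EuclideanSpace ℝ (Fin d) → EuclideanSpace 𝕜 (Fin d)} (hG : IsWeakGradient A G)
    (x : EuclideanSpace ℝ (Fin d)) {t : ℝ} (ht : 0 < t) :
    ∫ y, (-((t ^ (d + 1))⁻¹ * (d * χ (t⁻¹ • (x - y)) +
        fderiv ℝ χ (t⁻¹ • (x - y)) (t⁻¹ • (x - y))))) • A y =
      -(t ^ d)⁻¹ • ∑ i, ∫ y, ((t⁻¹ • (x - y)) i * χ (t⁻¹ • (x - y))) • G y i := by
  have hfc : Continuous (fderiv ℝ χ) := hχ.continuous_fderiv (by simp)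
  have hχc := hχ.continuous
  have key : ∀ i : Fin d, -∫ y, ((t⁻¹ • (x - y)) i * χ (t⁻¹ • (x - y))) • G y i =
      ∫ y, (-(t⁻¹ * (χ (t⁻¹ • (x - y)) + (t⁻¹ • (x - y)) i *
        fderiv ℝ χ (t⁻¹ • (x - y)) (EuclideanSpace.single i 1)))) • A y := by
    intro i
    rw [← hG.integral_eq (fun y => (t⁻¹ • (x - y)) i * χ (t⁻¹ • (x - y)))]
    · simp_rw [fderiv_coord_mul_profile (hχ.differentiable (by simp))]
    · fun_prop
    · exact HasCompactSupport.intro (isCompact_closedBall x (R * t))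
        fun y hy => by rw [profile_eq_zero_of_notMem hs ht x hy, mul_zero]
  have hint : ∀ i : Fin d, Integrable (fun y => (-(t⁻¹ * (χ (t⁻¹ • (x - y)) + (t⁻¹ • (x - y)) i *
        fderiv ℝ χ (t⁻¹ • (x - y)) (EuclideanSpace.single i 1)))) • A y) := by
    intro i
    refine integrable_profile_smul (η := fun ζ => -(t⁻¹ * (χ ζ + ζ i *
      fderiv ℝ χ ζ (EuclideanSpace.single i 1)))) (by fun_prop) (R := R) ?_
      hG.locallyIntegrable ht x
    intro ζ hζ
    simp [hs ζ hζ, fderiv_profile_eq_zero hs hζ]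
  rw [neg_smul, ← smul_neg, ← Finset.sum_neg_distrib]
  simp_rw [key]
  rw [← integral_finsetSum _ fun i _ => hint i, ← integral_smul]
  congr 1
  ext y
  rw [← Finset.sum_smul, smul_smul]
  congr 1
  rw [Finset.sum_neg_distrib, ← Finset.mul_sum, Finset.sum_add_distrib, sum_coord_mul_apply]
  simp only [Finset.sum_const, Finset.card_univ, Fintype.card_fin, nsmul_eq_mul]
  rw [pow_succ, mul_inv]
  ring

lemma norm_integral_coord_profile_le {χ : EuclideanSpace ℝ (Fin d) → ℝ}
    {R M : ℝ} (hR : 0 ≤ R) (hM : ∀ ζ, |χ ζ| ≤ M) (hs : ∀ ζ, R < ‖ζ‖ → χ ζ = 0)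
    {G : EuclideanSpace ℝ (Fin d) → EuclideanSpace 𝕜 (Fin d)} (hG : LocallyIntegrable G volume)
    (x : EuclideanSpace ℝ (Fin d)) {t : ℝ} (ht : 0 < t) (i : Fin d) :
    ‖∫ y, ((t⁻¹ • (x - y)) i * χ (t⁻¹ • (x - y))) • G y i‖ ≤
      R * M * ∫ y in Metric.closedBall x (R * t), ‖G y‖ := by
  rw [← integral_const_mul, ← integral_indicator measurableSet_closedBall]
  refine norm_integral_le_of_norm_le ?_ (Filter.Eventually.of_forall fun y => ?_)
  · rw [integrable_indicator_iff measurableSet_closedBall]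
    exact ((hG.integrableOn_isCompact (isCompact_closedBall _ _)).norm).const_mul _
  · by_cases hy : y ∈ Metric.closedBall x (R * t)
    · rw [Set.indicator_of_mem hy, norm_smul, norm_mul]
      have h1 : ‖(t⁻¹ • (x - y)) i‖ ≤ R := by
        refine (PiLp.norm_apply_le _ i).trans ?_
        rw [norm_smul, norm_inv, Real.norm_of_nonneg ht.le, inv_mul_eq_div, div_le_iff₀ ht,
          norm_sub_rev, ← dist_eq_norm]
        exact hy
      have h2 : ‖G y i‖ ≤ ‖G y‖ := PiLp.norm_apply_le _ i
      have h3 : ‖χ (t⁻¹ • (x - y))‖ ≤ M := hM _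
      exact mul_le_mul (mul_le_mul h1 h3 (norm_nonneg _) hR) h2 (norm_nonneg _)
        (mul_nonneg hR ((norm_nonneg _).trans h3))
    · simp [Set.indicator_of_notMem hy, profile_eq_zero_of_notMem hs ht x hy]

/-- Mean value inequality on `[t/2, t]`: `2 ^ d` comes from `(t/2)^{-d}`, `d` from the sum over
coordinates, `R * M` from `|ζᵢ χ(ζ)|`. The factor `1/2` from the interval length is dropped. -/
lemma norm_kernelAverage_sub_half_le {χ : EuclideanSpace ℝ (Fin d) → ℝ}
    (hχ : ContDiff ℝ (⊤ : ℕ∞) χ) {R M : ℝ} (hR : 0 ≤ R) (hM : ∀ ζ, |χ ζ| ≤ M)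
    (hs : ∀ ζ, R < ‖ζ‖ → χ ζ = 0) {A : EuclideanSpace ℝ (Fin d) → 𝕜}
    {G : EuclideanSpace ℝ (Fin d) → EuclideanSpace 𝕜 (Fin d)} (hG : IsWeakGradient A G)
    (x : EuclideanSpace ℝ (Fin d)) {t : ℝ} (ht : 0 < t) :
    ‖kernelAverage χ A x t - kernelAverage χ A x (t / 2)‖ ≤
      2 ^ d * d * R * M * (t * (t ^ d)⁻¹ * ∫ y in Metric.closedBall x (R * t), ‖G y‖) := by
  have hM0 : 0 ≤ M := (abs_nonneg _).trans (hM 0)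
  have hI : ∀ s, 0 ≤ ∫ y in Metric.closedBall x (R * s), ‖G y‖ := fun s =>
    integral_nonneg fun _ => norm_nonneg _
  have h := Convex.norm_image_sub_le_of_norm_hasDerivWithin_le (𝕜 := ℝ)
    (f := kernelAverage χ A x) (s := Set.Icc (t / 2) t) (x := t / 2) (y := t)
    (C := ((t / 2) ^ d)⁻¹ * (d * (R * M * ∫ y in Metric.closedBall x (R * t), ‖G y‖)))
    (fun s hs' => (hasDerivAt_kernelAverage hχ hR hs hG.locallyIntegrable x
      (by linarith [hs'.1])).hasDerivWithinAt) ?_ (convex_Icc _ _)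
    ⟨le_rfl, by linarith⟩ ⟨by linarith, le_rfl⟩
  · refine h.trans ?_
    rw [show t - t / 2 = t / 2 by ring, Real.norm_of_nonneg (by positivity), div_pow, inv_div]
    have : 0 ≤ 2 ^ d * d * R * M * (t * (t ^ d)⁻¹ * ∫ y in Metric.closedBall x (R * t), ‖G y‖) := by
      have := hI t
      positivity
    calc _ = 2 ^ d * d * R * M *
          (t * (t ^ d)⁻¹ * ∫ y in Metric.closedBall x (R * t), ‖G y‖) / 2 := by
          rw [div_eq_mul_inv]; ring
      _ ≤ _ := by linarith
  · intro s hs'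
    have hs0 : 0 < s := by linarith [hs'.1]
    rw [integral_deriv_kernel_eq hχ hs hG x hs0, norm_smul, norm_neg, norm_inv, norm_pow,
      Real.norm_of_nonneg hs0.le]
    have h1 : ‖∑ i, ∫ y, ((s⁻¹ • (x - y)) i * χ (s⁻¹ • (x - y))) • G y i‖ ≤
        d * (R * M * ∫ y in Metric.closedBall x (R * s), ‖G y‖) := by
      refine (norm_sum_le_of_le _ fun i _ =>
        norm_integral_coord_profile_le hR hM hs hG.locallyIntegrable_grad x hs0 i).trans ?_
      simp
    have h2 : ∫ y in Metric.closedBall x (R * s), ‖G y‖ ≤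
        ∫ y in Metric.closedBall x (R * t), ‖G y‖ := by
      refine setIntegral_mono_set
        (hG.locallyIntegrable_grad.integrableOn_isCompact (isCompact_closedBall _ _)).norm
        (Filter.Eventually.of_forall fun _ => norm_nonneg _) ?_
      exact (Metric.closedBall_subset_closedBall
        (mul_le_mul_of_nonneg_left hs'.2 hR)).eventuallyLE
    refine (mul_le_mul_of_nonneg_left h1 (by positivity)).trans ?_
    have := hI s
    gcongr
    exact hs'.1

end KernelAverage

/-! ### Dyadic sums. -/

lemma sum_range_min_dyadic_le {ρ : ℝ} (hρ : 0 ≤ ρ) (n : ℕ) {r : ℝ} (hr : 0 < r) :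
    ∑ k ∈ Finset.range n, min (r / 2 ^ k) (ρ ^ 2 / (r / 2 ^ k)) ≤ 4 * ρ := by
  -- Induction on `n`, passing from `r` to `r / 2`, needs this sharper form: a geometric tail below
  -- `ρ`, and above `ρ` a subtracted term that absorbs each new summand `ρ² / r`.
  suffices h : ∀ r : ℝ, 0 < r →
      (r ≤ ρ → ∑ k ∈ Finset.range n, min (r / 2 ^ k) (ρ ^ 2 / (r / 2 ^ k)) ≤ 2 * r) ∧
      (ρ < r → ∑ k ∈ Finset.range n, min (r / 2 ^ k) (ρ ^ 2 / (r / 2 ^ k)) ≤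
        4 * ρ - 2 * (ρ ^ 2 / r)) by
    obtain ⟨h1, h2⟩ := h r hr
    rcases le_or_gt r ρ with h | h
    · linarith [h1 h]
    · have : 0 ≤ ρ ^ 2 / r := by positivity
      linarith [h2 h]
  clear hr r
  induction n with
  | zero =>
    intro r hr
    refine ⟨fun _ => by simpa using hr.le, fun h => ?_⟩
    have : ρ ^ 2 / r ≤ ρ := by
      rw [div_le_iff₀ hr]
      nlinarith
    simp only [Finset.range_zero, Finset.sum_empty]
    linarith
  | succ n ih =>
    intro r hr
    obtain ⟨h1, h2⟩ := ih (r / 2) (by positivity)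
    have e : ∀ k : ℕ, r / 2 ^ (k + 1) = r / 2 / 2 ^ k := fun k => by rw [pow_succ']; field_simp
    rw [Finset.sum_range_succ']
    simp_rw [e]
    simp only [pow_zero, div_one]
    refine ⟨fun h => ?_, fun h => ?_⟩
    · have := h1 (by linarith)
      linarith [min_le_left r (ρ ^ 2 / r)]
    · have h3 := min_le_right r (ρ ^ 2 / r)
      rcases le_or_gt (r / 2) ρ with h' | h'
      · have h4 := h1 h'
        have h5 : 3 * (ρ ^ 2 / r) + r ≤ 4 * ρ := by
          -- This is `(r - ρ)(r - 3ρ) ≤ 0`, valid since `ρ < r ≤ 2ρ` at the crossing.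
          have : 3 * ρ ^ 2 + r * r ≤ 4 * ρ * r := by nlinarith
          calc 3 * (ρ ^ 2 / r) + r = (3 * ρ ^ 2 + r * r) / r := by field_simp
            _ ≤ 4 * ρ := by rwa [div_le_iff₀ hr]
        linarith
      · have h4 := h2 h'
        have h5 : ρ ^ 2 / (r / 2) = 2 * (ρ ^ 2 / r) := by field_simp
        have : 0 ≤ ρ ^ 2 / r := by positivity
        linarith

/-- For scales `s > ρ`, `(ρ / s) ^ d ≤ (ρ / s) ^ 2` reduces every dimension to the planar sum; this
is where `d ≥ 2` enters. -/
lemma sum_range_dyadic_le {d : ℕ} (hd : 2 ≤ d) {κ ρ r : ℝ} (hκ : 0 ≤ κ) (hρ : 0 ≤ ρ) (hr : 0 < r)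
    (n : ℕ) {a : ℕ → ℝ} (h1 : ∀ k, a k ≤ κ * (r / 2 ^ k) ^ d) (h2 : ∀ k, a k ≤ κ * ρ ^ d) :
    ∑ k ∈ Finset.range n, r / 2 ^ k * ((r / 2 ^ k) ^ d)⁻¹ * a k ≤ 4 * κ * ρ := by
  calc _ ≤ ∑ k ∈ Finset.range n, κ * min (r / 2 ^ k) (ρ ^ 2 / (r / 2 ^ k)) := by
        refine Finset.sum_le_sum fun k _ => ?_
        have hk : 0 < r / 2 ^ k := by positivity
        have h1 := h1 k
        have h2 := h2 k
        generalize r / 2 ^ k = s at *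
        rw [mul_min_of_nonneg _ _ hκ]
        refine le_min ?_ ?_
        · calc s * (s ^ d)⁻¹ * a k ≤ s * (s ^ d)⁻¹ * (κ * s ^ d) := by gcongr
            _ = κ * s := by field_simp
        · rcases le_or_gt s ρ with h | h
          · calc s * (s ^ d)⁻¹ * a k ≤ s * (s ^ d)⁻¹ * (κ * s ^ d) := by gcongr
              _ = κ * s := by field_simp
              _ ≤ κ * (ρ ^ 2 / s) := by
                gcongr
                rw [le_div_iff₀ hk]
                nlinarith
          · calc s * (s ^ d)⁻¹ * a k ≤ s * (s ^ d)⁻¹ * (κ * ρ ^ d) := by gcongr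
              _ = κ * (s * (ρ / s) ^ d) := by rw [div_pow]; field_simp
              _ ≤ κ * (s * (ρ / s) ^ 2) := by
                gcongr κ * (s * ?_)
                exact pow_le_pow_of_le_one (by positivity) ((div_le_one hk).2 h.le) hd
              _ = κ * (ρ ^ 2 / s) := by rw [div_pow]; field_simp
    _ = κ * ∑ k ∈ Finset.range n, min (r / 2 ^ k) (ρ ^ 2 / (r / 2 ^ k)) := by
        rw [Finset.mul_sum]
    _ ≤ κ * (4 * ρ) := by gcongr; exact sum_range_min_dyadic_le hρ n hr
    _ = _ := by ring

/-! ### Lorentz integrals over balls. -/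

/-- The layer-cake form `∫₀^∞ |{y ∈ S : |G y| > s}|^{1/d} ds` of the `L^{d,1}` norm of `G` on `S`. -/
noncomputable def lorentzIntegral {F : Type*} [Norm F] {d : ℕ}
    (G : EuclideanSpace ℝ (Fin d) → F) (S : Set (EuclideanSpace ℝ (Fin d))) : ℝ≥0∞ :=
  ∫⁻ s in Set.Ioi (0 : ℝ), (volume.restrict S {y | s < ‖G y‖}) ^ (1 / (d : ℝ))

section LorentzIntegral

variable {d : ℕ}

lemma antitone_measure_lt_norm {α F : Type*} [MeasurableSpace α] [Norm F] (μ : Measure α)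
    (G : α → F) : Antitone fun s : ℝ => μ {y | s < ‖G y‖} :=
  fun _ _ h => measure_mono fun _ hy => lt_of_le_of_lt h hy

lemma lorentzIntegral_mono {F : Type*} [Norm F] (G : EuclideanSpace ℝ (Fin d) → F)
    {S T : Set (EuclideanSpace ℝ (Fin d))} (h : S ⊆ T) :
    lorentzIntegral G S ≤ lorentzIntegral G T := by
  unfold lorentzIntegral
  gcongr

lemma volume_closedBall_eq_mul (x : EuclideanSpace ℝ (Fin d)) {r : ℝ} (hr : 0 ≤ r) :
    volume (Metric.closedBall x r) =
      ENNReal.ofReal (r ^ d) * volume (Metric.ball (0 : EuclideanSpace ℝ (Fin d)) 1) := by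
  rw [Measure.addHaar_closedBall _ _ hr, finrank_euclideanSpace_fin]

lemma sum_dyadic_integral_le (hd : 2 ≤ d) {R : ℝ} (hR : 0 ≤ R) {F : Type*} [NormedAddCommGroup F]
    {G : EuclideanSpace ℝ (Fin d) → F} (hG : LocallyIntegrable G volume)
    (x : EuclideanSpace ℝ (Fin d)) {r : ℝ} (hr : 0 < r) (n : ℕ) :
    ENNReal.ofReal (∑ k ∈ Finset.range n, r / 2 ^ k * ((r / 2 ^ k) ^ d)⁻¹ *
      ∫ y in Metric.closedBall x (R * (r / 2 ^ k)), ‖G y‖) ≤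
    ENNReal.ofReal (4 * max 1 (volume.real (Metric.ball (0 : EuclideanSpace ℝ (Fin d)) 1) * R ^ d))
      * lorentzIntegral G (Metric.closedBall x (R * r)) := by
  -- One constant for both bounds on a level set in the `k`-th ball: `1` for its measure in the
  -- largest ball, the other entry for the volume of the `k`-th ball.
  set κ := max 1 (volume.real (Metric.ball (0 : EuclideanSpace ℝ (Fin d)) 1) * R ^ d) with hκ
  have hκ1 : 1 ≤ κ := le_max_left _ _
  have hI : ∀ s, 0 ≤ ∫ y in Metric.closedBall x (R * s), ‖G y‖ := fun s =>
    integral_nonneg fun _ => norm_nonneg _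
  rw [ENNReal.ofReal_sum_of_nonneg (fun k _ => by have := hI (r / 2 ^ k); positivity)]
  set m : ℕ → ℝ → ℝ≥0∞ := fun k s =>
    volume.restrict (Metric.closedBall x (R * (r / 2 ^ k))) {y | s < ‖G y‖} with hm
  have hmeas : ∀ k, Measurable (m k) := fun k => (antitone_measure_lt_norm _ G).measurable
  have hcake : ∀ k : ℕ, ENNReal.ofReal (r / 2 ^ k * ((r / 2 ^ k) ^ d)⁻¹ *
      ∫ y in Metric.closedBall x (R * (r / 2 ^ k)), ‖G y‖) =
      ∫⁻ s in Set.Ioi (0 : ℝ), ENNReal.ofReal (r / 2 ^ k * ((r / 2 ^ k) ^ d)⁻¹) * m k s := by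
    intro k
    have hint := (hG.integrableOn_isCompact (isCompact_closedBall x (R * (r / 2 ^ k)))).norm
    rw [ENNReal.ofReal_mul (by positivity), lintegral_const_mul _ (hmeas k),
      ofReal_integral_eq_lintegral_ofReal hint (Filter.Eventually.of_forall fun _ => norm_nonneg _),
      lintegral_eq_lintegral_meas_lt _ (Filter.Eventually.of_forall fun _ => norm_nonneg _)
        hint.aemeasurable]
  simp_rw [hcake]
  rw [← lintegral_finsetSum _ fun k _ => (hmeas k).const_mul _]
  unfold lorentzIntegral
  rw [← lintegral_const_mul' _ _ ENNReal.ofReal_ne_top]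
  refine lintegral_mono fun s => ?_
  have hle0 : ∀ k, m k s ≤ m 0 s := by
    intro k
    refine Measure.restrict_mono_set volume (Metric.closedBall_subset_closedBall ?_) _
    rw [pow_zero, div_one]
    exact mul_le_mul_of_nonneg_left (div_le_self hr.le (one_le_pow₀ (by norm_num))) hR
  have hle1 : ∀ k, m k s ≤ ENNReal.ofReal (κ * (r / 2 ^ k) ^ d) := by
    intro k
    have hs : 0 ≤ r / 2 ^ k := by positivity
    calc m k s ≤ volume (Metric.closedBall x (R * (r / 2 ^ k))) :=
          (measure_mono (Set.subset_univ _)).trans_eq (Measure.restrict_apply_univ _)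
      _ = ENNReal.ofReal (volume.real (Metric.ball (0 : EuclideanSpace ℝ (Fin d)) 1) * R ^ d *
            (r / 2 ^ k) ^ d) := by
          rw [volume_closedBall_eq_mul _ (by positivity), mul_pow, mul_assoc,
            ENNReal.ofReal_mul measureReal_nonneg, ofReal_measureReal measure_ball_lt_top.ne,
            mul_comm]
      _ ≤ _ := by
          gcongr
          exact le_max_right _ _
  have hfin : ∀ k, m k s ≠ ⊤ := fun k => ((hle1 k).trans_lt ENNReal.ofReal_lt_top).ne
  have hd0 : d ≠ 0 := by omega
  have h2 : ∀ k, (m k s).toReal ≤ κ * ((m 0 s).toReal ^ (1 / (d : ℝ))) ^ d := by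
    intro k
    rw [one_div, Real.rpow_inv_natCast_pow ENNReal.toReal_nonneg hd0]
    have h3 := ENNReal.toReal_mono (hfin 0) (hle0 k)
    nlinarith [ENNReal.toReal_nonneg (a := m 0 s)]
  have h1 : ∀ k, (m k s).toReal ≤ κ * (r / 2 ^ k) ^ d := fun k =>
    ENNReal.toReal_le_of_le_ofReal (by positivity) (hle1 k)
  -- At each level `s`, `ρ` is the `d`-th root of the measure of the level set in the largest ball.
  have h := sum_range_dyadic_le hd (by positivity : 0 ≤ κ)
    (by positivity : 0 ≤ (m 0 s).toReal ^ (1 / (d : ℝ))) hr n h1 h2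
  have h0 : volume.restrict (Metric.closedBall x (R * r)) {y | s < ‖G y‖} = m 0 s := by
    simp [hm]
  rw [h0]
  calc ∑ k ∈ Finset.range n, ENNReal.ofReal (r / 2 ^ k * ((r / 2 ^ k) ^ d)⁻¹) * m k s
      = ENNReal.ofReal (∑ k ∈ Finset.range n,
          r / 2 ^ k * ((r / 2 ^ k) ^ d)⁻¹ * (m k s).toReal) := by
        rw [ENNReal.ofReal_sum_of_nonneg (fun k _ => by positivity)]
        refine Finset.sum_congr rfl fun k _ => ?_
        rw [ENNReal.ofReal_mul (p := r / 2 ^ k * ((r / 2 ^ k) ^ d)⁻¹) (by positivity),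
          ENNReal.ofReal_toReal (hfin k)]
    _ ≤ ENNReal.ofReal (4 * κ * (m 0 s).toReal ^ (1 / (d : ℝ))) := ENNReal.ofReal_le_ofReal h
    _ = ENNReal.ofReal (4 * κ) * m 0 s ^ (1 / (d : ℝ)) := by
        rw [ENNReal.ofReal_mul (by positivity),
          ← ENNReal.ofReal_rpow_of_nonneg ENNReal.toReal_nonneg (by positivity),
          ENNReal.ofReal_toReal (hfin 0)]

end LorentzIntegral

/-! ### Comparison with the rearrangement norm. -/

/-- Integrate `t^{1/p - 1}` over `(0, m)`. The indicator form prepares the exchange of integrals in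
`lorentzIntegral_univ_le`; infinite `m` is reached through arbitrary finite endpoints. -/
lemma rpow_le_lintegral_rpow_div {p : ℝ} (hp : 0 < p) (m : ℝ≥0∞) :
    m ^ (1 / p) ≤ ENNReal.ofReal (1 / p) * ∫⁻ t in Set.Ioi (0 : ℝ),
      {t : ℝ | ENNReal.ofReal t < m}.indicator
        (fun t => ENNReal.ofReal t ^ (1 / p) / ENNReal.ofReal t) t := by
  have hfin : ∀ a : ℝ, 0 ≤ a → ENNReal.ofReal a ^ (1 / p) ≤
      ENNReal.ofReal (1 / p) * ∫⁻ t in Set.Ioc (0 : ℝ) a,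
        ENNReal.ofReal t ^ (1 / p) / ENNReal.ofReal t := by
    intro a ha
    have hp1 : -1 < 1 / p - 1 := by
      have : 0 < 1 / p := by positivity
      linarith
    have h1 : ∫⁻ t in Set.Ioc (0 : ℝ) a, ENNReal.ofReal t ^ (1 / p) / ENNReal.ofReal t =
        ∫⁻ t in Set.Ioc (0 : ℝ) a, ENNReal.ofReal (t ^ (1 / p - 1)) := by
      refine setLIntegral_congr_fun measurableSet_Ioc fun t ht => ?_
      rw [Real.rpow_sub_one ht.1.ne', ENNReal.ofReal_div_of_pos ht.1,
        ENNReal.ofReal_rpow_of_pos ht.1]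
    have h2 := intervalIntegral.intervalIntegrable_rpow' (a := 0) (b := a) hp1
    rw [intervalIntegrable_iff_integrableOn_Ioc_of_le ha] at h2
    rw [h1, ← ofReal_integral_eq_lintegral_ofReal h2
      ((ae_restrict_iff' measurableSet_Ioc).2 (Filter.Eventually.of_forall fun t ht =>
        Real.rpow_nonneg ht.1.le _)), ← intervalIntegral.integral_of_le ha,
      integral_rpow (Or.inl hp1), sub_add_cancel, Real.zero_rpow (by positivity), sub_zero,
      ← ENNReal.ofReal_mul (by positivity), mul_div_cancel₀ _ (by positivity),
      ENNReal.ofReal_rpow_of_nonneg ha (by positivity)]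
  have hmono : ∀ a : ℝ, 0 ≤ a → ENNReal.ofReal a ≤ m → ENNReal.ofReal a ^ (1 / p) ≤
      ENNReal.ofReal (1 / p) * ∫⁻ t in Set.Ioi (0 : ℝ),
      {t : ℝ | ENNReal.ofReal t < m}.indicator
        (fun t => ENNReal.ofReal t ^ (1 / p) / ENNReal.ofReal t) t := by
    intro a ha ham
    refine (hfin a ha).trans ?_
    refine mul_le_mul_right ?_ _
    rw [setLIntegral_congr Ioo_ae_eq_Ioc.symm, ← lintegral_indicator measurableSet_Ioo,
      ← lintegral_indicator measurableSet_Ioi]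
    refine lintegral_mono fun t => ?_
    by_cases ht : t ∈ Set.Ioo 0 a
    · have ht' : t ∈ {t : ℝ | ENNReal.ofReal t < m} :=
        ((ENNReal.ofReal_lt_ofReal_iff (ht.1.trans ht.2)).2 ht.2).trans_le ham
      rw [Set.indicator_of_mem ht, Set.indicator_of_mem (Set.mem_Ioi.2 ht.1),
        Set.indicator_of_mem ht']
    · simp [Set.indicator_of_notMem ht]
  rcases eq_or_ne m ⊤ with rfl | hm
  · rw [ENNReal.top_rpow_of_pos (by positivity), top_le_iff]
    refine ENNReal.eq_top_of_forall_nnreal_le fun b => ?_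
    have := hmono ((b : ℝ) ^ p) (by positivity) le_top
    rwa [ENNReal.ofReal_rpow_of_nonneg (by positivity) (by positivity), ← Real.rpow_mul (by positivity),
      mul_one_div_cancel hp.ne', Real.rpow_one, ENNReal.ofReal_coe_nnreal] at this
  · have := hmono m.toReal ENNReal.toReal_nonneg (ENNReal.ofReal_toReal hm).le
    rwa [ENNReal.ofReal_toReal hm] at this

/-- A level `s` whose superlevel set has measure above `t` cannot exceed any admissible level in the
infimum, so all such `s` lie in `(0, f*(t)]`. -/
lemma volume_setOf_lt_measure_le_decreasingRearrangement {α F : Type*} [MeasurableSpace α]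
    [NormedAddCommGroup F] (μ : Measure α) (f : α → F) (t : ℝ≥0∞) :
    volume.restrict (Set.Ioi (0 : ℝ)) {s : ℝ | t < μ {y | s < ‖f y‖}} ≤
      decreasingRearrangement μ f t := by
  rcases eq_or_ne (decreasingRearrangement μ f t) ⊤ with h | h
  · rw [h]; exact le_top
  calc volume.restrict (Set.Ioi (0 : ℝ)) {s : ℝ | t < μ {y | s < ‖f y‖}}
      ≤ volume (Set.Ioc 0 (decreasingRearrangement μ f t).toReal) := by
        rw [Measure.restrict_apply' measurableSet_Ioi]
        refine measure_mono fun s hs => ⟨hs.2, ?_⟩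
        have hs0 : (0 : ℝ) < s := hs.2
        rw [← ENNReal.ofReal_le_iff_le_toReal h]
        refine le_csInf ⟨⊤, by simp⟩ fun s' hs' => ?_
        by_contra! hlt
        refine absurd (hs.1.trans_le ((measure_mono fun y hy => ?_).trans hs')) (lt_irrefl _)
        refine hlt.trans ?_
        rw [← ofReal_norm]
        exact (ENNReal.ofReal_lt_ofReal_iff_of_nonneg hs0.le).2 hy
    _ = _ := by rw [Real.volume_Ioc, sub_zero, ENNReal.ofReal_toReal h]

/-- Tonelli on the region `t < |{|G| > s}|`: integrating in `t` first gives the layer-cake form, in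
`s` first the rearrangement. -/
lemma lorentzIntegral_univ_le {F : Type*} [NormedAddCommGroup F] {d : ℕ} (hd : 0 < d)
    (G : EuclideanSpace ℝ (Fin d) → F) :
    lorentzIntegral G Set.univ ≤ lorentzNorm volume (d : ℝ) 1 G := by
  have hmeas : Measurable fun s : ℝ => volume {y | s < ‖G y‖} :=
    (antitone_measure_lt_norm volume G).measurable
  set k : ℝ → ℝ≥0∞ := fun t => ENNReal.ofReal t ^ (1 / (d : ℝ)) / ENNReal.ofReal t with hk
  have hkm : Measurable k := by fun_prop
  have hset : MeasurableSet {q : ℝ × ℝ | ENNReal.ofReal q.2 < volume {y | q.1 < ‖G y‖}} :=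
    measurableSet_lt (by fun_prop) (hmeas.comp measurable_fst)
  unfold lorentzIntegral lorentzNorm
  simp only [Measure.restrict_univ, ENNReal.rpow_one, div_one]
  calc ∫⁻ s in Set.Ioi (0 : ℝ), volume {y | s < ‖G y‖} ^ (1 / (d : ℝ))
      ≤ ∫⁻ s in Set.Ioi (0 : ℝ), ENNReal.ofReal (1 / d) * ∫⁻ t in Set.Ioi (0 : ℝ),
          {q : ℝ × ℝ | ENNReal.ofReal q.2 < volume {y | q.1 < ‖G y‖}}.indicator
            (fun q => k q.2) (s, t) :=
        lintegral_mono fun s => rpow_le_lintegral_rpow_div (by positivity) _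
    _ = ENNReal.ofReal (1 / d) * ∫⁻ t in Set.Ioi (0 : ℝ), ∫⁻ s in Set.Ioi (0 : ℝ),
          {q : ℝ × ℝ | ENNReal.ofReal q.2 < volume {y | q.1 < ‖G y‖}}.indicator
            (fun q => k q.2) (s, t) := by
        rw [lintegral_const_mul' _ _ ENNReal.ofReal_ne_top, lintegral_lintegral_swap]
        exact ((hkm.comp measurable_snd).indicator hset).aemeasurable
    _ ≤ _ := by
        gcongr with t
        calc ∫⁻ s in Set.Ioi (0 : ℝ),
              {q : ℝ × ℝ | ENNReal.ofReal q.2 < volume {y | q.1 < ‖G y‖}}.indicator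
                (fun q => k q.2) (s, t)
            = ∫⁻ s in Set.Ioi (0 : ℝ),
              {s : ℝ | ENNReal.ofReal t < volume {y | s < ‖G y‖}}.indicator (fun _ => k t) s := rfl
          _ = k t * volume.restrict (Set.Ioi (0 : ℝ))
                {s : ℝ | ENNReal.ofReal t < volume {y | s < ‖G y‖}} := by
              rw [lintegral_indicator_const (measurableSet_lt measurable_const hmeas)]
          _ ≤ k t * decreasingRearrangement volume G (ENNReal.ofReal t) := by
              gcongr
              exact volume_setOf_lt_measure_le_decreasingRearrangement _ _ _
          _ = _ := by
              simp only [hk, div_eq_mul_inv]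
              ring

/-! ### Disjoint sets and the covering argument. -/

/-- Minkowski's inequality, in the form `∑ (∫ fᵢ)ᵖ ≤ (∫ g)ᵖ` when `∑ fᵢᵖ ≤ gᵖ` pointwise. -/
lemma sum_lintegral_rpow_le_of_sum_rpow_le {α ι : Type*} [MeasurableSpace α] {μ : Measure α}
    {p : ℝ} (hp : 1 < p) (u : Finset ι) {f : ι → α → ℝ≥0∞} (hf : ∀ i, Measurable (f i))
    {g : α → ℝ≥0∞} (hg : ∫⁻ a, g a ∂μ ≠ ⊤) (h : ∀ a, ∑ i ∈ u, f i a ^ p ≤ g a ^ p) :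
    ∑ i ∈ u, (∫⁻ a, f i a ∂μ) ^ p ≤ (∫⁻ a, g a ∂μ) ^ p := by
  have hp0 : 0 < p := by linarith
  have hpq := Real.HolderConjugate.conjExponent hp
  set q := p.conjExponent
  set I : ι → ℝ≥0∞ := fun i => ∫⁻ a, f i a ∂μ with hI
  have hIle : ∀ i ∈ u, I i ≤ ∫⁻ a, g a ∂μ := by
    intro i hi
    refine lintegral_mono fun a => ?_
    rw [← ENNReal.rpow_le_rpow_iff hp0]
    exact (Finset.single_le_sum (f := fun i => f i a ^ p) (fun _ _ => zero_le) hi).trans (h a)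
  have hItop : ∀ i ∈ u, I i ≠ ⊤ := fun i hi => ((hIle i hi).trans_lt hg.lt_top).ne
  set S := ∑ i ∈ u, I i ^ p with hS
  have hStop : S ≠ ⊤ := by
    rw [hS, ENNReal.sum_ne_top]
    exact fun i hi => ENNReal.rpow_ne_top_of_nonneg hp0.le (hItop i hi)
  rcases eq_or_ne S 0 with h0 | h0
  · rw [h0]; exact zero_le
  -- Duality: pair the integrals with the weights `I i ^ (p - 1)`, apply Hölder pointwise, then
  -- cancel `S ^ (1 / q)`, which is finite and nonzero.
  have hmain : S ≤ S ^ (1 / q) * ∫⁻ a, g a ∂μ := by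
    calc S = ∑ i ∈ u, I i ^ (p - 1) * ∫⁻ a, f i a ∂μ := by
          refine Finset.sum_congr rfl fun i _ => ?_
          change I i ^ p = I i ^ (p - 1) * I i
          nth_rw 3 [← ENNReal.rpow_one (I i)]
          rw [← ENNReal.rpow_add_of_nonneg _ _ (by linarith) zero_le_one, sub_add_cancel]
      _ = ∫⁻ a, ∑ i ∈ u, I i ^ (p - 1) * f i a ∂μ := by
          rw [lintegral_finsetSum _ fun i _ => (hf i).const_mul _]
          exact Finset.sum_congr rfl fun i _ => (lintegral_const_mul _ (hf i)).symm
      _ ≤ ∫⁻ a, S ^ (1 / q) * g a ∂μ := by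
          refine lintegral_mono fun a => ?_
          refine (ENNReal.inner_le_Lp_mul_Lq u _ _ hpq.symm).trans ?_
          refine mul_le_mul' (ENNReal.rpow_le_rpow ?_ (one_div_nonneg.2 hpq.symm.nonneg)) ?_
          · refine (Finset.sum_congr rfl fun i _ => ?_).le
            rw [← ENNReal.rpow_mul, hpq.sub_one_mul_conj]
          · rw [one_div, ENNReal.rpow_inv_le_iff hp0]
            exact h a
      _ = _ := lintegral_const_mul' _ _
          (ENNReal.rpow_ne_top_of_nonneg (one_div_nonneg.2 hpq.symm.nonneg) hStop)
  have hsplit : S = S ^ (1 / q) * S ^ (1 / p) := by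
    rw [← ENNReal.rpow_add _ _ h0 hStop, one_div, one_div, add_comm, hpq.inv_add_inv_eq_one,
      ENNReal.rpow_one]
  have hle : S ^ (1 / p) ≤ ∫⁻ a, g a ∂μ := by
    have h1 : S ^ (1 / q) * S ^ (1 / p) ≤ S ^ (1 / q) * ∫⁻ a, g a ∂μ := hsplit ▸ hmain
    rwa [ENNReal.mul_le_mul_iff_right (by simp [ENNReal.rpow_eq_zero_iff, h0, hStop])
      (ENNReal.rpow_ne_top_of_nonneg (one_div_nonneg.2 hpq.symm.nonneg) hStop)] at h1
  rwa [one_div, ENNReal.rpow_inv_le_iff hp0] at hle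

/-- With `p = d`, the `d`-th powers of the integrands are measures of disjoint pieces of one level
set, so they add up to at most its full measure. -/
lemma sum_lorentzIntegral_pow_le {F ι : Type*} [Norm F] {d : ℕ} (hd : 2 ≤ d)
    (G : EuclideanSpace ℝ (Fin d) → F) (hG : lorentzIntegral G Set.univ ≠ ⊤) (u : Finset ι)
    {S : ι → Set (EuclideanSpace ℝ (Fin d))} (hS : ∀ i, MeasurableSet (S i))
    (hdisj : (u : Set ι).PairwiseDisjoint S) :
    ∑ i ∈ u, lorentzIntegral G (S i) ^ d ≤ lorentzIntegral G Set.univ ^ d := by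
  have hd0 : (d : ℝ) ≠ 0 := by positivity
  have h := sum_lintegral_rpow_le_of_sum_rpow_le (μ := volume.restrict (Set.Ioi (0 : ℝ)))
    (p := d) (by exact_mod_cast (by omega : 1 < d)) u
    (f := fun i s => (volume.restrict (S i) {y | s < ‖G y‖}) ^ (1 / (d : ℝ)))
    (fun i => (antitone_measure_lt_norm _ G).measurable.pow_const _) hG (fun s => ?_)
  · simpa only [ENNReal.rpow_natCast, lorentzIntegral] using h
  · simp only [← ENNReal.rpow_mul, one_div, inv_mul_cancel₀ hd0, ENNReal.rpow_one]
    rw [Measure.restrict_univ, ← Measure.finsetSum_apply,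
      ← Finset.sum_coe_sort u fun i => volume.restrict (S i), ← Measure.sum_fintype,
      ← Measure.restrict_biUnion_finset hdisj hS]
    exact Measure.restrict_apply_le _ _

lemma weak_type_of_lorentzIntegral_closedBall {F : Type*} [Norm F] {d : ℕ} (hd : 2 ≤ d)
    {G : EuclideanSpace ℝ (Fin d) → F} (hG : lorentzIntegral G Set.univ ≠ ⊤)
    {K : ℝ≥0∞} (hK : K ≠ ⊤) {l : ℝ} (hl : 0 < l) {X : Set (EuclideanSpace ℝ (Fin d))}
    (hX : ∀ x ∈ X, ∃ ρ : ℝ, 0 < ρ ∧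
      ENNReal.ofReal (l * ρ) ≤ K * lorentzIntegral G (Metric.closedBall x ρ)) :
    ENNReal.ofReal l ^ d * volume X ≤
      5 ^ d * volume (Metric.ball (0 : EuclideanSpace ℝ (Fin d)) 1) * K ^ d *
        lorentzIntegral G Set.univ ^ d := by
  choose! ρ hρ0 hρ using hX
  set N := lorentzIntegral G Set.univ with hN
  set v := volume (Metric.ball (0 : EuclideanSpace ℝ (Fin d)) 1)
  -- Vitali's lemma needs bounded radii; finiteness of `N` provides this.
  have hbound : ∀ x ∈ X, ρ x ≤ (K * N).toReal / l := by
    intro x hx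
    rw [le_div_iff₀ hl, mul_comm, ← ENNReal.ofReal_le_iff_le_toReal (ENNReal.mul_ne_top hK hG)]
    refine (hρ x hx).trans ?_
    gcongr
    exact lorentzIntegral_mono G (Set.subset_univ _)
  obtain ⟨u, huX, hdisj, hcov⟩ :=
    Vitali.exists_disjoint_subfamily_covering_enlargement_closedBall X id ρ _ hbound 5 (by norm_num)
  simp only [id] at hdisj hcov
  have hucount : u.Countable := hdisj.countable_of_nonempty_interior fun x hx =>
    ⟨x, Metric.ball_subset_interior_closedBall (Metric.mem_ball_self (hρ0 x (huX hx)))⟩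
  have hXsub : X ⊆ ⋃ b ∈ u, Metric.closedBall b (5 * ρ b) := by
    intro x hx
    obtain ⟨b, hb, hsub⟩ := hcov x hx
    exact Set.mem_biUnion hb (hsub (Metric.mem_closedBall_self (hρ0 x hx).le))
  have hterm : ∀ b : u, ENNReal.ofReal l ^ d * volume (Metric.closedBall b.1 (5 * ρ b)) ≤
      5 ^ d * v * K ^ d * lorentzIntegral G (Metric.closedBall b.1 (ρ b)) ^ d := by
    intro b
    have hb := (hρ0 b (huX b.2)).le
    rw [volume_closedBall_eq_mul _ (by positivity), mul_pow, ENNReal.ofReal_mul (by positivity)]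
    calc ENNReal.ofReal l ^ d * (ENNReal.ofReal (5 ^ d) * ENNReal.ofReal (ρ b ^ d) * v)
        = 5 ^ d * v * ENNReal.ofReal (l * ρ b) ^ d := by
          rw [ENNReal.ofReal_mul hl.le, ENNReal.ofReal_pow hb, ENNReal.ofReal_pow (by norm_num),
            ENNReal.ofReal_ofNat]
          ring
      _ ≤ 5 ^ d * v * (K * lorentzIntegral G (Metric.closedBall b.1 (ρ b))) ^ d := by
          gcongr
          exact hρ b (huX b.2)
      _ = _ := by rw [mul_pow, mul_assoc _ (K ^ d)]
  calc ENNReal.ofReal l ^ d * volume X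
      ≤ ENNReal.ofReal l ^ d * ∑' b : u, volume (Metric.closedBall b.1 (5 * ρ b)) := by
        gcongr
        exact (measure_mono hXsub).trans (measure_biUnion_le _ hucount _)
    _ = ∑' b : u, ENNReal.ofReal l ^ d * volume (Metric.closedBall b.1 (5 * ρ b)) :=
        ENNReal.tsum_mul_left.symm
    _ ≤ ∑' b : u, 5 ^ d * v * K ^ d * lorentzIntegral G (Metric.closedBall b.1 (ρ b)) ^ d :=
        ENNReal.tsum_le_tsum hterm
    _ = 5 ^ d * v * K ^ d * ∑' b : u, lorentzIntegral G (Metric.closedBall b.1 (ρ b)) ^ d :=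
        ENNReal.tsum_mul_left
    _ ≤ _ := by
        gcongr
        rw [ENNReal.tsum_eq_iSup_sum]
        refine iSup_le fun w => sum_lorentzIntegral_pow_le hd G hG w
          (fun _ => measurableSet_closedBall) ?_
        intro a _ b _ hab
        exact hdisj a.2 b.2 fun h => hab (Subtype.ext h)

/-! ### Uniform convergence of the averages and the continuous representative. -/

section ContinuousRepresentative

variable {𝕜 : Type*} [RCLike 𝕜] {d : ℕ}

lemma enorm_kernelAverage_sub_dyadic_le (hd : 2 ≤ d) {χ : EuclideanSpace ℝ (Fin d) → ℝ}
    (hχ : ContDiff ℝ (⊤ : ℕ∞) χ) {R M : ℝ} (hR : 0 ≤ R) (hM : ∀ ζ, |χ ζ| ≤ M)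
    (hs : ∀ ζ, R < ‖ζ‖ → χ ζ = 0) {A : EuclideanSpace ℝ (Fin d) → 𝕜}
    {G : EuclideanSpace ℝ (Fin d) → EuclideanSpace 𝕜 (Fin d)} (hG : IsWeakGradient A G)
    (x : EuclideanSpace ℝ (Fin d)) {r : ℝ} (hr : 0 < r) (n : ℕ) :
    ‖kernelAverage χ A x r - kernelAverage χ A x (r / 2 ^ n)‖ₑ ≤
      ENNReal.ofReal (2 ^ d * d * R * M) * ENNReal.ofReal
        (4 * max 1 (volume.real (Metric.ball (0 : EuclideanSpace ℝ (Fin d)) 1) * R ^ d)) *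
        lorentzIntegral G (Metric.closedBall x (R * r)) := by
  have hM0 : 0 ≤ M := (abs_nonneg _).trans (hM 0)
  rw [mul_assoc]
  refine le_trans ?_ (mul_le_mul_right
    (sum_dyadic_integral_le hd hR hG.locallyIntegrable_grad x hr n) _)
  rw [← ENNReal.ofReal_mul (by positivity), ← ofReal_norm]
  refine ENNReal.ofReal_le_ofReal ?_
  have htel := Finset.sum_range_sub' (fun k : ℕ => kernelAverage χ A x (r / 2 ^ k)) n
  simp only [pow_zero, div_one] at htel
  rw [← htel, Finset.mul_sum]
  refine norm_sum_le_of_le _ fun k _ => ?_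
  have := norm_kernelAverage_sub_half_le hχ hR hM hs hG x (by positivity : 0 < r / 2 ^ k)
  rwa [div_div, ← pow_succ] at this

/-- The bump function equal to `1` on the ball of radius `r / 2` and supported in that of radius
`r`. -/
noncomputable def halfBump (d : ℕ) (r : ℝ) (hr : 0 < r) :
    ContDiffBump (0 : EuclideanSpace ℝ (Fin d)) :=
  ⟨r / 2, r, half_pos hr, half_lt_self hr⟩

/-- The ratio of outer to inner radius is always `2`, so all these bumps are dilates of one profile.
Hence `kernelAverage` is a convolution with normalized bumps, to which Lebesgue differentiation
applies. -/
lemma halfBump_apply {r : ℝ} (hr : 0 < r) (z : EuclideanSpace ℝ (Fin d)) :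
    halfBump d r hr z = halfBump d 1 one_pos (r⁻¹ • z) := by
  change (someContDiffBumpBase _).toFun (r / (r / 2)) ((r / 2)⁻¹ • (z - 0)) =
    (someContDiffBumpBase _).toFun (1 / (1 / 2)) ((1 / 2 : ℝ)⁻¹ • (r⁻¹ • z - 0))
  rw [sub_zero, sub_zero, smul_smul]
  congr 1
  · field_simp
  · congr 1
    field_simp

lemma halfBump_normed_apply {r : ℝ} (hr : 0 < r) (z : EuclideanSpace ℝ (Fin d)) :
    (halfBump d r hr).normed volume z =
      (r ^ d)⁻¹ * (halfBump d 1 one_pos).normed volume (r⁻¹ • z) := by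
  simp only [ContDiffBump.normed_def, halfBump_apply hr]
  rw [Measure.integral_comp_smul volume (fun z => halfBump d 1 one_pos z) r⁻¹,
    finrank_euclideanSpace_fin, inv_pow, inv_inv, abs_of_pos (by positivity), smul_eq_mul]
  field_simp

lemma kernelAverage_halfBump (A : EuclideanSpace ℝ (Fin d) → 𝕜) (x : EuclideanSpace ℝ (Fin d))
    {r : ℝ} (hr : 0 < r) :
    kernelAverage ((halfBump d 1 one_pos).normed volume) A x r =
      convolution ((halfBump d r hr).normed volume) A (ContinuousLinearMap.lsmul ℝ ℝ) volume x := by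
  rw [convolution_lsmul_swap, kernelAverage]
  simp_rw [halfBump_normed_apply hr]

/-- Moving the centre by `t • v` amounts to translating the profile, so the scale estimates at `x`
also cover off-centre averages. -/
lemma kernelAverage_comp_add (χ : EuclideanSpace ℝ (Fin d) → ℝ)
    (A : EuclideanSpace ℝ (Fin d) → 𝕜) (x v : EuclideanSpace ℝ (Fin d)) {t : ℝ} (ht : 0 < t) :
    kernelAverage (fun ζ => χ (ζ + v)) A x t = kernelAverage χ A (x + t • v) t := by
  unfold kernelAverage
  congr 1
  ext y
  rw [show t⁻¹ • (x + t • v - y) = t⁻¹ • (x - y) + v by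
    rw [add_sub_right_comm, smul_add, inv_smul_smul₀ ht.ne']]

/-- The Lorentz integral of `G` over sets of measure at most `b`. -/
noncomputable def lorentzModulus {F : Type*} [Norm F] (G : EuclideanSpace ℝ (Fin d) → F)
    (b : ℝ≥0∞) : ℝ≥0∞ :=
  ∫⁻ s in Set.Ioi (0 : ℝ), (min (volume {y | s < ‖G y‖}) b) ^ (1 / (d : ℝ))

lemma lorentzIntegral_le_lorentzModulus {F : Type*} [Norm F] (G : EuclideanSpace ℝ (Fin d) → F)
    (S : Set (EuclideanSpace ℝ (Fin d))) :
    lorentzIntegral G S ≤ lorentzModulus G (volume S) := by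
  refine lintegral_mono fun s => ?_
  refine ENNReal.rpow_le_rpow (le_min (Measure.restrict_apply_le _ _) ?_) (by positivity)
  exact (measure_mono (Set.subset_univ _)).trans_eq (Measure.restrict_apply_univ _)

lemma lorentzModulus_le {F : Type*} [Norm F] (G : EuclideanSpace ℝ (Fin d) → F) (b : ℝ≥0∞) :
    lorentzModulus G b ≤ lorentzIntegral G Set.univ := by
  refine lintegral_mono fun s => ?_
  rw [Measure.restrict_univ]
  exact ENNReal.rpow_le_rpow (min_le_left _ _) (by positivity)

/-- Dominated convergence in the level `s`. As `lorentzModulus` sees only the volume of a ball, the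
resulting smallness is uniform in its centre. -/
lemma tendsto_lorentzModulus {F : Type*} [Norm F] (hd : 0 < d) {G : EuclideanSpace ℝ (Fin d) → F}
    (hG : lorentzIntegral G Set.univ ≠ ⊤) {b : ℕ → ℝ≥0∞}
    (hb : Filter.Tendsto b Filter.atTop (nhds 0)) :
    Filter.Tendsto (fun n => lorentzModulus G (b n)) Filter.atTop (nhds 0) := by
  have hmeas : Measurable fun s : ℝ => volume {y | s < ‖G y‖} :=
    (antitone_measure_lt_norm volume G).measurable
  have h := tendsto_lintegral_of_dominated_convergence (μ := volume.restrict (Set.Ioi (0 : ℝ)))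
    (F := fun n s => (min (volume {y | s < ‖G y‖}) (b n)) ^ (1 / (d : ℝ))) (f := fun _ => 0)
    (fun s => volume.restrict Set.univ {y | s < ‖G y‖} ^ (1 / (d : ℝ)))
    (fun n => (hmeas.min measurable_const).pow_const _)
    (fun n => Filter.Eventually.of_forall fun s => by
      simp only [Measure.restrict_univ]
      exact ENNReal.rpow_le_rpow (min_le_left _ _) (by positivity)) hG
    (Filter.Eventually.of_forall fun s => ?_)
  · rwa [lintegral_zero] at h
  · have hb' : Filter.Tendsto (fun n => b n ^ (1 / (d : ℝ))) Filter.atTop (nhds 0) := by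
      have := ((ENNReal.continuous_rpow_const (y := 1 / (d : ℝ))).tendsto 0).comp hb
      rwa [ENNReal.zero_rpow_of_pos (by positivity)] at this
    exact tendsto_of_tendsto_of_tendsto_of_le_of_le tendsto_const_nhds hb' (fun _ => zero_le)
      fun n => ENNReal.rpow_le_rpow (min_le_right _ _) (by positivity)

lemma exists_continuous_ae_eq_enorm_sub_kernelAverage_le (hd : 2 ≤ d) {M : ℝ}
    (hM : ∀ ζ : EuclideanSpace ℝ (Fin d), |(halfBump d 1 one_pos).normed volume ζ| ≤ M)
    {A : EuclideanSpace ℝ (Fin d) → 𝕜}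
    {G : EuclideanSpace ℝ (Fin d) → EuclideanSpace 𝕜 (Fin d)} (hG : IsWeakGradient A G)
    (hGfin : lorentzIntegral G Set.univ ≠ ⊤) {r : ℝ} (hr : 0 < r) :
    ∃ B : EuclideanSpace ℝ (Fin d) → 𝕜, Continuous B ∧ B =ᵐ[volume] A ∧
      ∀ x v : EuclideanSpace ℝ (Fin d), ‖v‖ ≤ 1 →
        ‖kernelAverage ((halfBump d 1 one_pos).normed volume) A (x + r • v) r - B x‖ₑ ≤
          ENNReal.ofReal (2 ^ d * d * 2 * M) * ENNReal.ofReal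
            (4 * max 1 (volume.real (Metric.ball (0 : EuclideanSpace ℝ (Fin d)) 1) * 2 ^ d)) *
            lorentzIntegral G (Metric.closedBall x (2 * r)) := by
  set φ : EuclideanSpace ℝ (Fin d) → ℝ := (halfBump d 1 one_pos).normed volume with hφ
  set K := ENNReal.ofReal (2 ^ d * d * 2 * M) * ENNReal.ofReal
    (4 * max 1 (volume.real (Metric.ball (0 : EuclideanSpace ℝ (Fin d)) 1) * 2 ^ d)) with hK
  have hKtop : K ≠ ⊤ := ENNReal.mul_ne_top ENNReal.ofReal_ne_top ENNReal.ofReal_ne_top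
  have hφs : ∀ ζ, 1 < ‖ζ‖ → φ ζ = 0 := by
    intro ζ hζ
    by_contra hne
    have : ζ ∈ Function.support φ := hne
    rw [hφ, ContDiffBump.support_normed_eq] at this
    have : ‖ζ‖ < 1 := by simpa [halfBump] using this
    linarith
  have hφd : ContDiff ℝ (⊤ : ℕ∞) φ := ContDiffBump.contDiff_normed _
  -- A profile supported in the unit ball and translated by `‖v‖ ≤ 1` lives in the ball of radius
  -- `2`, whence `R = 2`.
  have hdy : ∀ x v : EuclideanSpace ℝ (Fin d), ‖v‖ ≤ 1 → ∀ t : ℝ, 0 < t → ∀ n : ℕ,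
      ‖kernelAverage φ A (x + t • v) t - kernelAverage φ A (x + (t / 2 ^ n) • v) (t / 2 ^ n)‖ₑ ≤
        K * lorentzIntegral G (Metric.closedBall x (2 * t)) := by
    intro x v hv t ht n
    rw [← kernelAverage_comp_add φ A x v ht, ← kernelAverage_comp_add φ A x v (by positivity)]
    refine enorm_kernelAverage_sub_dyadic_le hd (hφd.comp (by fun_prop)) (by norm_num)
      (fun ζ => hM _) (fun ζ hζ => hφs _ ?_) hG x ht n
    have := norm_sub_le (ζ + v) v
    rw [add_sub_cancel_right] at this
    linarith
  set u : ℕ → EuclideanSpace ℝ (Fin d) → 𝕜 := fun n x => kernelAverage φ A x (r / 2 ^ n) with hu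
  have hrn : ∀ n : ℕ, 0 < r / 2 ^ n := fun n => by positivity
  have hrlim : Filter.Tendsto (fun n : ℕ => r / 2 ^ n) Filter.atTop (nhds 0) := by
    have := (tendsto_pow_atTop_nhds_zero_of_lt_one (r := (1 / 2 : ℝ)) (by norm_num)
      (by norm_num)).const_mul r
    simpa [div_eq_mul_inv] using this
  set β : ℕ → ℝ≥0∞ := fun n => ENNReal.ofReal ((2 * (r / 2 ^ n)) ^ d) *
    volume (Metric.ball (0 : EuclideanSpace ℝ (Fin d)) 1) with hβ
  have hβlim : Filter.Tendsto β Filter.atTop (nhds 0) := by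
    have h1 : Filter.Tendsto (fun n : ℕ => ENNReal.ofReal ((2 * (r / 2 ^ n)) ^ d)) Filter.atTop
        (nhds 0) := by
      have := ENNReal.tendsto_ofReal ((hrlim.const_mul 2).pow d)
      simpa [show d ≠ 0 by omega] using this
    simpa using ENNReal.Tendsto.mul_const h1 (Or.inr (measure_ball_lt_top (μ := volume)).ne)
  set b : ℕ → ℝ := fun n => (K * lorentzModulus G (β n)).toReal with hb
  have hbtop : ∀ n, K * lorentzModulus G (β n) ≠ ⊤ := fun n =>
    ENNReal.mul_ne_top hKtop ((lorentzModulus_le G _).trans_lt hGfin.lt_top).ne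
  have hblim : Filter.Tendsto b Filter.atTop (nhds 0) := by
    have h1 := ENNReal.Tendsto.const_mul (tendsto_lorentzModulus (by omega) hGfin hβlim)
      (Or.inr hKtop)
    rw [mul_zero] at h1
    exact (ENNReal.tendsto_toReal ENNReal.zero_ne_top).comp h1
  have hdist : ∀ x n m, n ≤ m → dist (u n x) (u m x) ≤ b n := by
    intro x n m hnm
    have h1 := hdy x 0 (by simp) (r / 2 ^ n) (hrn n) (m - n)
    rw [smul_zero, smul_zero, add_zero, div_div, ← pow_add, Nat.add_sub_cancel' hnm] at h1
    have h2 : lorentzIntegral G (Metric.closedBall x (2 * (r / 2 ^ n))) ≤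
        lorentzModulus G (β n) := by
      refine (lorentzIntegral_le_lorentzModulus G _).trans_eq ?_
      rw [volume_closedBall_eq_mul _ (by positivity)]
    rw [dist_eq_norm, ← toReal_enorm]
    exact ENNReal.toReal_mono (hbtop n) (h1.trans (by gcongr))
  have hcau : ∀ x, ∃ y, Filter.Tendsto (fun n => u n x) Filter.atTop (nhds y) := fun x =>
    cauchySeq_tendsto_of_complete (cauchySeq_of_le_tendsto_0' b (fun n m => hdist x n m) hblim)
  choose B hB using hcau
  have hBdist : ∀ x n, dist (u n x) (B x) ≤ b n := fun x n =>
    le_of_tendsto (tendsto_const_nhds.dist (hB x))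
      (Filter.eventually_atTop.2 ⟨n, fun m hm => hdist x n m hm⟩)
  have hunif : TendstoUniformly u B Filter.atTop := by
    rw [Metric.tendstoUniformly_iff]
    intro ε hε
    filter_upwards [hblim.eventually (gt_mem_nhds hε)] with n hn x
    rw [dist_comm]
    exact (hBdist x n).trans_lt hn
  have hucont : ∀ n, Continuous (u n) := by
    intro n
    have : u n = convolution ((halfBump d _ (hrn n)).normed volume) A
        (ContinuousLinearMap.lsmul ℝ ℝ) volume := by
      ext x
      exact kernelAverage_halfBump A x (hrn n)
    rw [this]
    exact (ContDiffBump.hasCompactSupport_normed _).continuous_convolution_left _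
      (ContDiffBump.continuous_normed _) hG.locallyIntegrable
  have hBcont : Continuous B := hunif.continuous (Filter.Frequently.of_forall hucont)
  refine ⟨B, hBcont, ?_, fun x v hv => ?_⟩
  · have h := ContDiffBump.ae_convolution_tendsto_right_of_locallyIntegrable (μ := volume)
      (φ := fun n : ℕ => halfBump d _ (hrn n)) (l := Filter.atTop) (K := 2) hrlim
      (Filter.Eventually.of_forall fun n => by simp [halfBump]; linarith) hG.locallyIntegrable
    filter_upwards [h] with x hx
    refine tendsto_nhds_unique (hB x) (hx.congr fun n => ?_)
    exact (kernelAverage_halfBump A x (hrn n)).symm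
  -- The centres `x + (r / 2 ^ n) • v` move with `n`; uniform convergence and continuity of `B`
  -- still give the limit `B x`.
  · have h1 : Filter.Tendsto (fun n : ℕ => u n (x + (r / 2 ^ n) • v)) Filter.atTop
        (nhds (B x)) := by
      refine hunif.tendsto_comp hBcont.continuousAt ?_
      simpa using (hrlim.smul_const v).const_add x
    exact le_of_tendsto ((continuous_enorm.tendsto _).comp (tendsto_const_nhds.sub h1))
      (Filter.Eventually.of_forall fun n => hdy x v hv r hr n)

end ContinuousRepresentative

/-! ### The weak-type inequality. -/

theorem lemma2p2 {𝕜 : Type*} [RCLike 𝕜] (d : ℕ) (hd : 2 ≤ d) :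
    ∃ C : ℝ≥0, ∀ (A : EuclideanSpace ℝ (Fin d) → 𝕜)
      (G : EuclideanSpace ℝ (Fin d) → EuclideanSpace 𝕜 (Fin d)),
      IsWeakGradient A G → MemLorentz volume (d : ℝ) 1 G →
      ∃ B : EuclideanSpace ℝ (Fin d) → 𝕜, Continuous B ∧ B =ᵐ[volume] A ∧
        ∀ l : ℝ, 0 < l →
          ENNReal.ofReal l ^ d *
              volume {x : EuclideanSpace ℝ (Fin d) | ENNReal.ofReal l < maryWeissMaximal B x} ≤
            C * lorentzNorm volume (d : ℝ) 1 G ^ d := by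
  obtain ⟨M, hM⟩ := ((halfBump d 1 one_pos).hasCompactSupport_normed
    (μ := volume)).exists_bound_of_continuous (ContDiffBump.continuous_normed _)
  set K := ENNReal.ofReal (2 ^ d * d * 2 * M) * ENNReal.ofReal
    (4 * max 1 (volume.real (Metric.ball (0 : EuclideanSpace ℝ (Fin d)) 1) * 2 ^ d)) with hK
  have hKtop : K ≠ ⊤ := ENNReal.mul_ne_top ENNReal.ofReal_ne_top ENNReal.ofReal_ne_top
  -- In `6 * K`, `2` counts the two comparisons with a common average and `3` comes from the radius
  -- `3 * ‖h‖`.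
  set C := 5 ^ d * volume (Metric.ball (0 : EuclideanSpace ℝ (Fin d)) 1) * (6 * K) ^ d with hC
  have h6K : 6 * K ≠ ⊤ := ENNReal.mul_ne_top (by simp) hKtop
  have hCtop : C ≠ ⊤ := ENNReal.mul_ne_top
    (ENNReal.mul_ne_top (by simp) measure_ball_lt_top.ne) (ENNReal.pow_ne_top h6K)
  refine ⟨C.toNNReal, fun A G hG hGL => ?_⟩
  rw [ENNReal.coe_toNNReal hCtop]
  have hNle := lorentzIntegral_univ_le (by omega : 0 < d) G
  have hNfin : lorentzIntegral G Set.univ ≠ ⊤ := (hNle.trans_lt hGL.2).ne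
  obtain ⟨B, hBc, hBA, -⟩ :=
    exists_continuous_ae_eq_enorm_sub_kernelAverage_le hd hM hG hNfin one_pos
  have hBr : ∀ r : ℝ, 0 < r → ∀ x v : EuclideanSpace ℝ (Fin d), ‖v‖ ≤ 1 →
      ‖kernelAverage ((halfBump d 1 one_pos).normed volume) A (x + r • v) r - B x‖ₑ ≤
        K * lorentzIntegral G (Metric.closedBall x (2 * r)) := by
    intro r hr
    obtain ⟨B', hBc', hBA', h⟩ :=
      exists_continuous_ae_eq_enorm_sub_kernelAverage_le hd hM hG hNfin hr
    -- Continuous functions equal almost everywhere coincide, so a single `B` serves all scales.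
    rwa [(Continuous.ae_eq_iff_eq volume hBc' hBc).1 (hBA'.trans hBA.symm)] at h
  refine ⟨B, hBc, hBA, fun l hl => ?_⟩
  refine (weak_type_of_lorentzIntegral_closedBall hd hNfin h6K hl fun x hx => ?_).trans
    (mul_le_mul_right (pow_le_pow_left' hNle d) _)
  simp only [maryWeissMaximal, Set.mem_ofPred_eq, lt_iSup_iff] at hx
  obtain ⟨h, hh, hlt⟩ := hx
  have hr : 0 < ‖h‖ := norm_pos_iff.2 hh
  refine ⟨3 * ‖h‖, by positivity, ?_⟩
  -- The average centred at `x + h` is off-centre for `x` (`v = h / ‖h‖`) and centred for `x + h`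
  -- (`v = 0`); both balls of radius `2 * ‖h‖` lie in the one of radius `3 * ‖h‖` about `x`.
  have h1 := hBr ‖h‖ hr x (‖h‖⁻¹ • h) (by rw [norm_smul, norm_inv, norm_norm,
    inv_mul_cancel₀ hr.ne'])
  have h2 := hBr ‖h‖ hr (x + h) 0 (by simp)
  rw [smul_inv_smul₀ hr.ne'] at h1
  rw [smul_zero, add_zero] at h2
  have hdiff : ‖B (x + h) - B x‖ₑ ≤
      2 * K * lorentzIntegral G (Metric.closedBall x (3 * ‖h‖)) := by
    set w := kernelAverage ((halfBump d 1 one_pos).normed volume) A (x + h) ‖h‖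
    calc ‖B (x + h) - B x‖ₑ = ‖(w - B x) - (w - B (x + h))‖ₑ := by congr 1; ring
      _ ≤ ‖w - B x‖ₑ + ‖w - B (x + h)‖ₑ := enorm_sub_le
      _ ≤ K * lorentzIntegral G (Metric.closedBall x (3 * ‖h‖)) +
          K * lorentzIntegral G (Metric.closedBall x (3 * ‖h‖)) := by
        refine add_le_add (h1.trans ?_) (h2.trans ?_)
        · gcongr
          exact lorentzIntegral_mono G (Metric.closedBall_subset_closedBall (by linarith))
        · gcongr
          refine lorentzIntegral_mono G (Metric.closedBall_subset_closedBall' ?_)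
          rw [dist_self_add_left]
          linarith
      _ = _ := by ring
  have hlt' : ENNReal.ofReal (l * ‖h‖) ≤ ‖B (x + h) - B x‖ₑ := by
    rw [ENNReal.ofReal_mul hl.le, ofReal_norm]
    exact ENNReal.mul_le_of_le_div hlt.le
  calc ENNReal.ofReal (l * (3 * ‖h‖)) = 3 * ENNReal.ofReal (l * ‖h‖) := by
        rw [mul_left_comm, ENNReal.ofReal_mul (by norm_num), ENNReal.ofReal_ofNat]
    _ ≤ 3 * (2 * K * lorentzIntegral G (Metric.closedBall x (3 * ‖h‖))) := by
        gcongr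
        exact hlt'.trans hdiff
    _ = _ := by ring
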